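/- Let $k\ge 1$ and let $\nu$ be a probability measure on the ranked $k$-simplex $\{s=(s_1,\dots,s_k): s_1\ge\dots\ge s_k\ge 0,\ \sum_{i=1}^k s_i=1\}$ with $\nu(\{(1,0,\dots,0)\})<1$. Let $\mathcal P^{(k)}$ be the space of partitions of $\mathbb N$ with at most $k$ blocks, with the $\sigma$-algebra generated by the restrictions $B\mapsto B_{|[n]}$, $n\in\mathbb N$, where $[n]=\{1,\dots,n\}$, and let $\mathcal P^{(k)}_{[n]}$ be the set of partitions of $[n]$ with at most $k$ blocks. For $s$ in the simplex let $\varrho_s$ be the law of the random partition in which $i\sim j$ if and only if $X_i=X_j$, where $X_1,X_2,\dots$ are i.i.d. with $\mathbb P(X_i=j)=s_j$ for $1\le j\le k$; put $\varrho_\nu=\int\varrho_s\,\nu(ds)$. For a partition $\pi$ of a finite set $b\subset\mathbb N$ write $\varrho_\nu(\pi)$ for the probability that a $\varrho_\nu$-distributed partition restricts to $\pi$ on $b$, and write $\#\pi$ for the number of blocks of $\pi$. For $B,B'\in\mathcal P^{(k)}_{[n]}$ let $$p_n(B,B';\nu)=\frac{k!}{(k-\#B')!}\prod_{b\in B}\frac{(k-\#B'_{|b})!}{k!}\,\varrho_\nu(B'_{|b}).$$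 The $\varrho_\nu$-Markov chain is the discrete-time Markov chain on $\mathcal P^{(k)}$ whose transition probability has finite-dimensional restrictions $p_n(\cdot,\cdot;\nu)$, $n\in\mathbb N$. For $\lambda>0$ let $Q^\nu_n$ be the matrix with entries $Q^\nu_n(B,B')=\lambda\, p_n(B,B';\nu)$ for $B\ne B'$ and $Q^\nu_n(B,B)=\lambda\,(p_n(B,B;\nu)-1)$. A $\varrho_\nu$-Markov process is a process $(B(t),t\ge 0)$ on $\mathcal P^{(k)}$ such that, for each $n$, the restriction $B_{|[n]}$ is a continuous-time Markov process on $\mathcal P^{(k)}_{[n]}$ with $Q$-matrix $Q^\nu_n$; its transition semigroup is the family of Markov kernels on $\mathcal P^{(k)}$ whose finite-dimensional restrictions are $e^{tQ^\nu_n}$, $t\ge0$, $n\in\mathbb N$. Then there is a probability measure $\theta(\cdot;\nu)$ on $\mathcal P^{(k)}$ that is the unique stationary distribution of the $\varrho_\nu$-Markov chain and, for every $\lambda>0$, is also the unique stationary distribution of the continuous-time $\varrho_\nu$-Markov process: it is the only probability measure invariant under the transition semigroup, and a $\varrho_\nu$-Markov process $(B(t),t\ge0)$ has the same one-dimensional law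 at all times $t\ge 0$ if and only if $B(0)\sim\theta(\cdot;\nu)$. -/

import Mathlib

open MeasureTheory ProbabilityTheory Set
open scoped NNReal ENNReal Nat

noncomputable section

/-- Partitions of `α`, viewed as equivalence relations, with at most `k` blocks. -/
def PartitionAtMost (α : Type) (k : ℕ) : Type :=
  {r : Setoid α // r.classes.encard ≤ k}

namespace PartitionAtMost

variable {α β : Type} {k : ℕ}

theorem encard_classes_comap_le (f : β → α) (r : Setoid α) :
    (r.comap f).classes.encard ≤ r.classes.encard := by
  have hsub : (r.comap f).classes ⊆ (fun c => f ⁻¹' c) '' r.classes := by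
    rintro _ ⟨y, rfl⟩
    exact ⟨{x | r x (f y)}, ⟨f y, rfl⟩, rfl⟩
  exact (encard_le_encard hsub).trans (encard_image_le _ _)

/-- The partition of `β` obtained by pulling back along `f : β → α`. For an injection this is the
restriction of the partition to a subset. -/
def comap (f : β → α) (B : PartitionAtMost α k) : PartitionAtMost β k :=
  ⟨B.1.comap f, (encard_classes_comap_le f B.1).trans B.2⟩

/-- The restriction `B_{|[n]}` of a partition of the natural numbers to the first `n` of them. -/
def restrict (n : ℕ) (B : PartitionAtMost ℕ k) : PartitionAtMost (Fin n) k :=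
  B.comap Fin.val

/-- The number of blocks `#B`. -/
def numBlocks (B : PartitionAtMost α k) : ℕ := B.1.classes.ncard

/-- The number of blocks `#B_{|b}` of the restriction of `B` to the subset `b`. -/
def numBlocksOn (B : PartitionAtMost α k) (b : Set α) : ℕ :=
  (B.comap (Subtype.val : b → α)).numBlocks

/-- The finite set of blocks of `B`. -/
def blocks [Finite α] (B : PartitionAtMost α k) : Finset (Set α) :=
  (Set.toFinite B.1.classes).toFinset

/-- The partition `Π(x)`, with `i ∼ j` if and only if `x i = x j`. -/
def ofColoring (x : α → Fin k) : PartitionAtMost α k :=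
  ⟨Setoid.ker x, by
    have h := encard_le_encard (Setoid.classes_ker_subset_fiber_set x)
    have h2 : {t | ∃ y : Fin k, {z | x z = y} = t}.encard ≤ k := by
      have : {t | ∃ y : Fin k, {z | x z = y} = t} = (fun y => {z | x z = y}) '' univ := by
        ext t
        simp
      rw [this]
      refine (encard_image_le _ _).trans ?_
      simp
    exact h.trans h2⟩

instance [Finite α] : Finite (PartitionAtMost α k) := by
  have : Function.Injective (fun (B : PartitionAtMost α k) => fun i j => B.1 i j) := by
    intro B C h
    apply Subtype.ext
    ext i j
    exact iff_of_eq (congrFun (congrFun h i) j)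
  exact Finite.of_injective _ this

instance [Finite α] : Fintype (PartitionAtMost α k) := Fintype.ofFinite _

instance : DecidableEq (PartitionAtMost α k) := Classical.decEq _

/-- The σ-algebra on partitions of the natural numbers generated by all finite restrictions. -/
instance : MeasurableSpace (PartitionAtMost ℕ k) :=
  ⨆ n : ℕ, MeasurableSpace.comap (restrict n) ⊤

end PartitionAtMost

/-- The ranked `k`-simplex: `s₁ ≥ ... ≥ s_k ≥ 0` with `∑ s_i = 1`. -/
abbrev RankedSimplex (k : ℕ) : Type :=
  {s : Fin k → ℝ // Antitone s ∧ (∀ i, 0 ≤ s i) ∧ ∑ i, s i = 1}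

/-- The singleton consisting of the point `(1, 0, ..., 0)` of the ranked `k`-simplex. -/
def oneBlockMass (k : ℕ) : Set (RankedSimplex k) :=
  {s | ∀ i : Fin k, s.1 i = if (i : ℕ) = 0 then 1 else 0}

/-- The distribution on `{1, ..., k}` that gives mass `s_j` to `j`. -/
def colorLaw {k : ℕ} (s : RankedSimplex k) : Measure (Fin k) :=
  ∑ j, ENNReal.ofReal (s.1 j) • Measure.dirac j

instance {k : ℕ} (s : RankedSimplex k) : IsProbabilityMeasure (colorLaw s) := by
  constructor
  simp only [colorLaw, Measure.coe_finsetSum, Measure.coe_smul, Finset.sum_apply, Pi.smul_apply,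
    measure_univ, smul_eq_mul, mul_one]
  rw [← ENNReal.ofReal_sum_of_nonneg (fun i _ => s.2.2.1 i), s.2.2.2, ENNReal.ofReal_one]

theorem measurable_ofColoring {k : ℕ} :
    Measurable (PartitionAtMost.ofColoring : (ℕ → Fin k) → PartitionAtMost ℕ k) := by
  rw [measurable_iff_comap_le]
  change MeasurableSpace.comap _ (⨆ n : ℕ, MeasurableSpace.comap (PartitionAtMost.restrict n) ⊤) ≤ _
  rw [MeasurableSpace.comap_iSup]
  refine iSup_le fun n => ?_
  rw [MeasurableSpace.comap_comp]
  have h : (PartitionAtMost.restrict n ∘ PartitionAtMost.ofColoring : (ℕ → Fin k) → _) =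
      (PartitionAtMost.ofColoring : (Fin n → Fin k) → PartitionAtMost (Fin n) k) ∘
        (fun x (i : Fin n) => x i) := by
    funext x
    rfl
  rw [h, ← measurable_iff_comap_le]
  let _ : MeasurableSpace (PartitionAtMost (Fin n) k) := ⊤
  exact (measurable_of_finite _).comp (measurable_pi_lambda _ fun i => measurable_pi_apply _)

/-- The paintbox `ϱ_s`: the law of `Π(X)` for `X₁, X₂, ...` i.i.d. with law `s`. -/
def paintbox {k : ℕ} (s : RankedSimplex k) : Measure (PartitionAtMost ℕ k) :=
  (Measure.infinitePi fun _ : ℕ => colorLaw s).map PartitionAtMost.ofColoring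

theorem measurable_paintbox {k : ℕ} :
    Measurable (paintbox : RankedSimplex k → Measure (PartitionAtMost ℕ k)) := by
  refine (Measure.measurable_map _ measurable_ofColoring).comp ?_
  refine Measurable.measure_of_isPiSystem_of_isProbabilityMeasure
    (MeasureTheory.generateFrom_squareCylinders (α := fun _ : ℕ => Fin k)).symm
    (MeasureTheory.isPiSystem_squareCylinders (fun _ => MeasurableSpace.isPiSystem_measurableSet) (fun _ => MeasurableSet.univ (α := Fin k))) ?_
  rintro S hS
  simp only [squareCylinders, mem_ofPred_eq] at hS
  obtain ⟨I, t, hS, rfl⟩ := hS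
  have ht : ∀ i ∈ I, MeasurableSet (t i) := fun i _ => by simp
  simp only [Measure.infinitePi_pi _ ht]
  refine Finset.measurable_fun_prod _ fun i _ => ?_
  simp only [colorLaw, Measure.coe_finsetSum, Measure.coe_smul, Finset.sum_apply, Pi.smul_apply, smul_eq_mul]
  refine Finset.measurable_fun_sum _ fun j _ => ?_
  refine Measurable.mul_const ?_ _
  exact ENNReal.measurable_ofReal.comp ((measurable_pi_apply j).comp measurable_subtype_coe)

/-- The `ν`-mixture of paintboxes `ϱ_ν = ∫ ϱ_s ν(ds)`. -/
def paintboxMixture {k : ℕ} (ν : Measure (RankedSimplex k)) : Measure (PartitionAtMost ℕ k) :=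
  ν.bind paintbox

instance {k : ℕ} (ν : Measure (RankedSimplex k)) [IsProbabilityMeasure ν] :
    IsProbabilityMeasure (paintboxMixture ν) := by
  constructor
  have h (s : RankedSimplex k) : paintbox s univ = 1 := by
    rw [paintbox, Measure.map_apply measurable_ofColoring MeasurableSet.univ]
    simp
  rw [paintboxMixture, Measure.bind_apply MeasurableSet.univ measurable_paintbox.aemeasurable]
  simp [h]

/-- `ϱ_ν(B_{|b})`: the probability that a `ϱ_ν`-partition and `B` have the same restriction to the
subset `b` of `[n]`. -/
def paintboxProbOn {k n : ℕ} (ν : Measure (RankedSimplex k)) (B : PartitionAtMost (Fin n) k)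
    (b : Set (Fin n)) : ℝ :=
  (paintboxMixture ν).real {C | ∀ i ∈ b, ∀ j ∈ b, C.1 i j ↔ B.1 i j}

/-- The finite-dimensional transition probabilities
`p_n(B, B'; ν) = k! / (k - #B')! * ∏_{b ∈ B} (k - #B'_{|b})! / k! * ϱ_ν(B'_{|b})`. -/
def transitionProb {k n : ℕ} (ν : Measure (RankedSimplex k))
    (B B' : PartitionAtMost (Fin n) k) : ℝ :=
  (k ! : ℝ) / ((k - B'.numBlocks)! : ℝ) *
    ∏ b ∈ B.blocks, ((k - B'.numBlocksOn b)! : ℝ) / (k ! : ℝ) * paintboxProbOn ν B' b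

/-- The `Q`-matrix `Q_n` with entries `rate * p_n(B, B'; ν)` off the diagonal and
`rate * (p_n(B, B; ν) - 1)` on it. -/
def rateMatrix {k : ℕ} (rate : ℝ) (ν : Measure (RankedSimplex k)) (n : ℕ) :
    Matrix (PartitionAtMost (Fin n) k) (PartitionAtMost (Fin n) k) ℝ :=
  fun B B' => rate * if B = B' then transitionProb ν B B - 1 else transitionProb ν B B'

/-- `p` is the transition probability of the `ϱ_ν`-Markov chain: its finite-dimensional
restrictions are the `p_n(·, ·; ν)`. (These determine `p`.) -/
structure IsChainKernel {k : ℕ} (ν : Measure (RankedSimplex k))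
    (p : Kernel (PartitionAtMost ℕ k) (PartitionAtMost ℕ k)) : Prop where
  isMarkovKernel : IsMarkovKernel p
  restrict_eq : ∀ (n : ℕ) (A : PartitionAtMost ℕ k) (B' : PartitionAtMost (Fin n) k),
    (p A).real {A' | A'.restrict n = B'} = transitionProb ν (A.restrict n) B'

/-- `μ` is a stationary distribution of the `ϱ_ν`-Markov chain. -/
def IsStationaryForChain {k : ℕ} (ν : Measure (RankedSimplex k))
    (μ : Measure (PartitionAtMost ℕ k)) : Prop :=
  ∃ p, IsChainKernel ν p ∧ p.Invariant μ

/-- `X` is a continuous-time Markov process on the finite set `E` with `Q`-matrix `Q`: it is Markov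
with transition matrices `exp (t Q)`, expressed through its finite-dimensional distributions. -/
def IsMarkovWithQMatrix {Ω : Type*} [MeasurableSpace Ω] {E : Type} [Fintype E] [DecidableEq E]
    (Q : Matrix E E ℝ) (P : Measure Ω) (X : ℝ≥0 → Ω → E) : Prop :=
  ∀ (m : ℕ) (t : Fin (m + 1) → ℝ≥0), Monotone t → ∀ x : Fin (m + 1) → E,
    P.real {ω | ∀ i, X (t i) ω = x i} =
      P.real {ω | X (t 0) ω = x 0} *
        ∏ i : Fin m, NormedSpace.exp (((t i.succ : ℝ) - (t i.castSucc : ℝ)) • Q)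
          (x i.castSucc) (x i.succ)

/-- `B` is a (continuous-time) `ϱ_ν`-Markov process with jump rate `rate`: for each `n` its
restriction to `[n]` is a Markov process with `Q`-matrix `Q_n`. -/
structure IsRhoMarkovProcess {Ω : Type*} [MeasurableSpace Ω] {k : ℕ} (rate : ℝ)
    (ν : Measure (RankedSimplex k)) (P : Measure Ω) (B : ℝ≥0 → Ω → PartitionAtMost ℕ k) :
    Prop where
  measurable : ∀ t, Measurable (B t)
  restrict_markov : ∀ n : ℕ,
    IsMarkovWithQMatrix (rateMatrix rate ν n) P (fun t ω => (B t ω).restrict n)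

/-- `T` is the transition semigroup of the `ϱ_ν`-Markov process: `T t π` is the law of the process
at time `t` started at `π`, so that its restriction to `[n]` is governed by `exp (t Q_n)`.
(These restrictions determine `T`, and they give the semigroup property.) -/
structure IsRhoMarkovSemigroup {k : ℕ} (rate : ℝ) (ν : Measure (RankedSimplex k))
    (T : ℝ≥0 → Kernel (PartitionAtMost ℕ k) (PartitionAtMost ℕ k)) : Prop where
  isMarkovKernel : ∀ t, IsMarkovKernel (T t)
  restrict_eq : ∀ (t : ℝ≥0) (n : ℕ) (A : PartitionAtMost ℕ k) (B' : PartitionAtMost (Fin n) k),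
    (T t A).real {A' | A'.restrict n = B'} =
      NormedSpace.exp ((t : ℝ) • rateMatrix rate ν n) (A.restrict n) B'

/-- `μ` is a stationary distribution of the transition semigroup of the `ϱ_ν`-Markov process. -/
def IsStationaryForSemigroup {k : ℕ} (rate : ℝ) (ν : Measure (RankedSimplex k))
    (μ : Measure (PartitionAtMost ℕ k)) : Prop :=
  ∃ T, IsRhoMarkovSemigroup rate ν T ∧ ∀ t, (T t).Invariant μ

end

noncomputable section


/-! A partition with at most `k` blocks is the level-set partition of a `k`-coloring, and a finite
partition `π` has exactly `k!/(k-#π)!` such colorings. This explains the factorials in `p_n`: color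
each block of `B` independently by a mixture of i.i.d. colorings whose colors are then permuted
uniformly, and take the level sets of the resulting global coloring. Carried out on `ℕ`, this gives
one Markov kernel `chainKernel` whose restrictions are all the `p_n` (`isChainKernel_chainKernel`).
A Poisson number of its steps gives the continuous-time semigroup, since `exp (c (P - 1))` is the
Poisson mixture of the powers of `P`.

Uniqueness is a Doeblin argument on each `[n]`. The largest mass of `s` is at least `1/k`, so the
one-block partition is reached from every state with positive probability in one step. A stochastic
matrix with a positive column contracts vectors of total mass zero in `ℓ¹`, so stationary marginals
are unique, and the marginals determine the law on `ℕ`. For the semigroup the same argument is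
applied at time `1`.

Existence is a Krylov–Bogoliubov argument. Cesàro averages of the laws of the chain are lifted to
the compact space `ℕ → Fin k`, where they have a limit along an ultrafilter. Finite restrictions
pass to the limit, and telescoping makes it invariant. Poissonization preserves invariance, so one
`θ` serves both time scales and all rates. -/

/-! ### Counting colorings with a given level-set partition -/

theorem Setoid.ncard_classes_ker {α β : Type*} (f : α → β) :
    (Setoid.ker f).classes.ncard = (range f).ncard := by
  rw [← Nat.card_coe_set_eq, ← Nat.card_coe_set_eq]
  exact Nat.card_congr
    ((Setoid.quotientEquivClasses (Setoid.ker f)).symm.trans (Setoid.quotientKerEquivRange f))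

/-- Both ranges are identified with the common quotient, which gives a bijection between them;
finiteness of `γ` lets it extend to a permutation. -/
theorem exists_perm_comp_eq {β γ : Type*} [Finite γ] {x y : β → γ}
    (h : Setoid.ker y = Setoid.ker x) : ∃ σ : Equiv.Perm γ, ⇑σ ∘ y = x := by
  classical
  have := Fintype.ofFinite γ
  let e : range y ≃ range x := (Setoid.quotientKerEquivRange y).symm.trans
    ((Quotient.congr (Equiv.refl β) fun a b => by
      rw [h]; rfl).trans (Setoid.quotientKerEquivRange x))
  have he (b : β) : (e ⟨y b, mem_range_self b⟩ : γ) = x b := by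
    have : (Setoid.quotientKerEquivRange y).symm ⟨y b, mem_range_self b⟩ =
        Quotient.mk (Setoid.ker y) b := by
      rw [Equiv.symm_apply_eq]; rfl
    simp only [e, Equiv.trans_apply, this]
    rfl
  refine ⟨Equiv.extendSubtype (p := (· ∈ range y)) (q := (· ∈ range x)) e, funext fun b => ?_⟩
  rw [Function.comp_apply, Equiv.extendSubtype_apply_of_mem _ _ (mem_range_self b), he]

theorem card_perm_comp_eq_self {β γ : Type*} [Fintype γ] (x : β → γ) :
    Nat.card {σ : Equiv.Perm γ // ⇑σ ∘ x = x} = (Fintype.card γ - (range x).ncard)! := by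
  classical
  have e : {σ : Equiv.Perm γ // ⇑σ ∘ x = x} ≃ Equiv.Perm {c // c ∉ range x} :=
    (Equiv.subtypeEquivRight fun σ => by
      constructor
      · rintro h a ha
        obtain ⟨b, rfl⟩ := not_not.1 ha
        exact congrFun h b
      · intro h
        exact funext fun b => h _ (not_not.2 (mem_range_self b))).trans
      (Equiv.Perm.subtypeEquivSubtypePerm (· ∉ range x)).symm
  rw [Nat.card_congr e, Nat.card_perm]
  congr 1
  have := Set.ncard_add_ncard_compl (range x)
  rw [Nat.card_eq_fintype_card] at this
  have h2 : Nat.card {c // c ∉ range x} = (range x)ᶜ.ncard := Nat.card_coe_set_eq _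
  omega

/-- The solutions form a coset of the pointwise stabilizer of `range x`, which is the symmetric
group of the complement. -/
theorem card_perm_comp_eq {β γ : Type*} [Fintype γ] {x y : β → γ}
    (h : Setoid.ker y = Setoid.ker x) :
    Nat.card {σ : Equiv.Perm γ // ⇑σ ∘ y = x} = (Fintype.card γ - (range x).ncard)! := by
  obtain ⟨σ₀, h₀⟩ := exists_perm_comp_eq h
  rw [← card_perm_comp_eq_self x]
  refine Nat.card_congr ((Equiv.mulRight σ₀⁻¹).subtypeEquiv fun σ => ?_)
  subst h₀
  simp [Function.comp_def]

theorem ker_eq_of_perm_comp_eq {β γ : Type*} {x y : β → γ} (σ : Equiv.Perm γ)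
    (h : ⇑σ ∘ y = x) : Setoid.ker y = Setoid.ker x := by
  subst h
  ext a b
  simp [Setoid.ker_def]

open Classical in
theorem sum_perm_ite_comp_eq {R : Type*} [Semiring R] {β γ : Type*} [Fintype γ] [DecidableEq γ]
    (x y : β → γ) :
    ∑ σ : Equiv.Perm γ, (if ⇑σ ∘ y = x then (1 : R) else 0) =
      if Setoid.ker y = Setoid.ker x then ((Fintype.card γ - (range x).ncard)! : R) else 0 := by
  split_ifs with h
  · rw [← card_perm_comp_eq h, Nat.card_eq_fintype_card, Fintype.card_subtype, Finset.sum_boole]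
  · refine Finset.sum_eq_zero fun σ _ => if_neg fun hσ => h (ker_eq_of_perm_comp_eq σ hσ)

open Classical in
theorem sum_perm_indicator_comp_eq {β γ : Type*} [Fintype γ] [DecidableEq γ] (x y : β → γ) :
    ∑ σ : Equiv.Perm γ, {y : β → γ | ⇑σ ∘ y = x}.indicator (1 : (β → γ) → ℝ≥0∞) y =
      ((Fintype.card γ - (range x).ncard)! : ℝ≥0∞) *
        {y : β → γ | Setoid.ker y = Setoid.ker x}.indicator (1 : (β → γ) → ℝ≥0∞) y := by
  simpa only [indicator_apply, mem_ofPred_eq, Pi.one_apply, mul_ite, mul_one, mul_zero] using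
    sum_perm_ite_comp_eq (R := ℝ≥0∞) x y

open Classical in
-- Double counting of the pairs `(σ, y)` with `σ ∘ y = x`: each `σ` determines `y`, while each `y`
-- with the kernel of `x` admits a fixed number of `σ`.
theorem card_colorings_ker_mul_factorial {β γ : Type*} [Fintype β] [Fintype γ] (x : β → γ) :
    (Finset.univ.filter fun y : β → γ => Setoid.ker y = Setoid.ker x).card *
      (Fintype.card γ - (range x).ncard)! = (Fintype.card γ)! := by
  have h := Finset.sum_comm (s := (Finset.univ : Finset (Equiv.Perm γ)))
    (t := (Finset.univ : Finset (β → γ))) (f := fun σ y => if ⇑σ ∘ y = x then 1 else 0)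
  have h1 (σ : Equiv.Perm γ) : ∑ y : β → γ, (if ⇑σ ∘ y = x then 1 else 0) = 1 := by
    rw [Finset.sum_eq_single (⇑σ.symm ∘ x)]
    · simp [← Function.comp_assoc]
    · rintro y - hy
      refine if_neg fun e => hy ?_
      rw [← e, ← Function.comp_assoc]
      simp
    · simp
  have h2 (y : β → γ) : ∑ σ : Equiv.Perm γ, (if ⇑σ ∘ y = x then 1 else 0) =
      if Setoid.ker y = Setoid.ker x then (Fintype.card γ - (range x).ncard)! else 0 := by
    convert sum_perm_ite_comp_eq (R := ℕ) x y
    rw [Nat.cast_id]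
  simp only [h1, h2, ← Finset.sum_filter, Finset.sum_const, Finset.card_univ, Fintype.card_perm,
    smul_eq_mul, mul_one] at h
  exact h.symm

/-! ### Partitions as colorings, and finite restrictions -/

namespace PartitionAtMost

variable {α β : Type} {k : ℕ}

theorem exists_ofColoring_eq [Finite α] (B : PartitionAtMost α k) :
    ∃ x : α → Fin k, ofColoring x = B := by
  have hc : Nat.card (Quotient B.1) ≤ Nat.card (Fin k) := by
    have h := B.2
    rw [← (Set.toFinite B.1.classes).cast_ncard_eq, Nat.cast_le] at h
    rw [Nat.card_congr (Setoid.quotientEquivClasses B.1), Nat.card_coe_set_eq]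
    simpa using h
  have := Fintype.ofFinite (Quotient B.1)
  rw [Nat.card_eq_fintype_card, Nat.card_eq_fintype_card] at hc
  obtain ⟨e⟩ := Function.Embedding.nonempty_of_card_le hc
  refine ⟨fun a => e (Quotient.mk B.1 a), Subtype.ext (Setoid.ext fun a b => ?_)⟩
  change e _ = e _ ↔ _
  rw [e.injective.eq_iff, Quotient.eq]

theorem ofColoring_eq_iff {x y : α → Fin k} :
    ofColoring x = ofColoring y ↔ Setoid.ker x = Setoid.ker y := Subtype.ext_iff

theorem numBlocks_ofColoring (x : α → Fin k) : (ofColoring x).numBlocks = (range x).ncard :=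
  Setoid.ncard_classes_ker x

theorem numBlocksOn_ofColoring (x : α → Fin k) (b : Set α) :
    (ofColoring x).numBlocksOn b = (range fun i : b => x i).ncard :=
  Setoid.ncard_classes_ker _

theorem card_colorings [Fintype α] [DecidableEq α] (B : PartitionAtMost α k) :
    ((Finset.univ.filter fun x : α → Fin k => ofColoring x = B).card : ℝ) =
      (k ! : ℝ) / ((k - B.numBlocks)! : ℝ) := by
  obtain ⟨x, rfl⟩ := exists_ofColoring_eq B
  rw [eq_div_iff (by positivity), numBlocks_ofColoring]
  have := card_colorings_ker_mul_factorial x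
  rw [Fintype.card_fin] at this
  simp only [← ofColoring_eq_iff] at this
  norm_cast
  convert this

theorem restrict_ofColoring (n : ℕ) (x : ℕ → Fin k) :
    (ofColoring x).restrict n = ofColoring fun i : Fin n => x i := rfl

theorem restrict_surjective (hk : 0 < k) (n : ℕ) :
    Function.Surjective (restrict n : PartitionAtMost ℕ k → PartitionAtMost (Fin n) k) := by
  intro B
  obtain ⟨x, rfl⟩ := exists_ofColoring_eq B
  refine ⟨ofColoring fun i => if h : i < n then x ⟨i, h⟩ else ⟨0, hk⟩, ?_⟩
  rw [restrict_ofColoring]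
  simp

theorem measurable_restrict (n : ℕ) :
    Measurable[_, ⊤] (restrict n : PartitionAtMost ℕ k → PartitionAtMost (Fin n) k) :=
  measurable_iff_comap_le.2 (le_iSup (fun n => MeasurableSpace.comap (restrict n) ⊤) n)

theorem measurableSet_restrict_eq (n : ℕ) (B : PartitionAtMost (Fin n) k) :
    MeasurableSet {A : PartitionAtMost ℕ k | A.restrict n = B} :=
  measurable_restrict n (MeasurableSpace.measurableSet_top (s := {B}))

theorem measurableSet_rel (i j : ℕ) : MeasurableSet {A : PartitionAtMost ℕ k | A.1 i j} :=
  measurable_restrict (max i j + 1) (MeasurableSpace.measurableSet_top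
    (s := {B : PartitionAtMost (Fin (max i j + 1)) k | B.1 ⟨i, by omega⟩ ⟨j, by omega⟩}))

/-- Probability measures on partitions of `ℕ` are determined by their finite restrictions. -/
theorem measure_ext {μ μ' : Measure (PartitionAtMost ℕ k)} [IsProbabilityMeasure μ]
    [IsProbabilityMeasure μ']
    (h : ∀ (n : ℕ) (B : PartitionAtMost (Fin n) k),
      μ.real {A | A.restrict n = B} = μ'.real {A | A.restrict n = B}) : μ = μ' := by
  refine ext_of_generate_finite {s | ∃ (n : ℕ) (S : Set (PartitionAtMost (Fin n) k)),
    restrict n ⁻¹' S = s} ?_ ?_ ?_ (by simp)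
  · change (⨆ n : ℕ, MeasurableSpace.comap (restrict n) ⊤) = _
    rw [MeasurableSpace.measurableSpace_iSup_eq]
    simp [MeasurableSpace.measurableSet_comap]
  · rintro _ ⟨m, S, rfl⟩ _ ⟨n, S', rfl⟩ -
    -- Two cylinders are both visible at the larger level, so cylinders form a π-system.
    refine ⟨max m n, {B | B.comap (Fin.castLE (le_max_left m n)) ∈ S ∧
      B.comap (Fin.castLE (le_max_right m n)) ∈ S'}, ?_⟩
    rfl
  · rintro _ ⟨n, S, rfl⟩
    have : restrict n ⁻¹' S = ⋃ B ∈ (Set.toFinite S).toFinset, {A | A.restrict n = B} := by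
      ext A
      simp
    rw [this, ← measureReal_eq_measureReal_iff (measure_ne_top _ _) (measure_ne_top _ _)]
    rw [measureReal_biUnion_finset, measureReal_biUnion_finset]
    · exact Finset.sum_congr rfl fun B _ => h n B
    all_goals first
      | exact fun B _ => measurableSet_restrict_eq n B
      | exact fun B _ B' _ hBB' => Set.disjoint_left.2 fun A hA hA' => hBB' (hA.symm.trans hA')

end PartitionAtMost

/-! ### Mixtures of i.i.d. colorings and their symmetrization -/

theorem measurable_infinitePi_colorLaw {k : ℕ} :
    Measurable fun s : RankedSimplex k => Measure.infinitePi fun _ : ℕ => colorLaw s := by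
  refine Measurable.measure_of_isPiSystem_of_isProbabilityMeasure
    (MeasureTheory.generateFrom_squareCylinders (α := fun _ : ℕ => Fin k)).symm
    (MeasureTheory.isPiSystem_squareCylinders (fun _ => MeasurableSpace.isPiSystem_measurableSet)
      (fun _ => MeasurableSet.univ (α := Fin k))) ?_
  rintro S hS
  simp only [squareCylinders, mem_ofPred_eq] at hS
  obtain ⟨I, t, hS, rfl⟩ := hS
  have ht : ∀ i ∈ I, MeasurableSet (t i) := fun i _ => by simp
  simp only [Measure.infinitePi_pi _ ht]
  refine Finset.measurable_fun_prod _ fun i _ => ?_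
  simp only [colorLaw, Measure.coe_finsetSum, Measure.coe_smul, Finset.sum_apply, Pi.smul_apply,
    smul_eq_mul]
  refine Finset.measurable_fun_sum _ fun j _ => Measurable.mul_const ?_ _
  exact ENNReal.measurable_ofReal.comp ((measurable_pi_apply j).comp measurable_subtype_coe)

/-- The `ν`-mixture of the laws of i.i.d. sequences of colors. -/
def iidColorMixture {k : ℕ} (ν : Measure (RankedSimplex k)) : Measure (ℕ → Fin k) :=
  ν.bind fun s => Measure.infinitePi fun _ : ℕ => colorLaw s

instance {k : ℕ} (ν : Measure (RankedSimplex k)) [IsProbabilityMeasure ν] :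
    IsProbabilityMeasure (iidColorMixture ν) := by
  constructor
  rw [iidColorMixture, Measure.bind_apply MeasurableSet.univ
    measurable_infinitePi_colorLaw.aemeasurable]
  simp

theorem map_iidColorMixture {k : ℕ} (ν : Measure (RankedSimplex k)) :
    (iidColorMixture ν).map PartitionAtMost.ofColoring = paintboxMixture ν := by
  ext S hS
  rw [Measure.map_apply measurable_ofColoring hS, iidColorMixture,
    Measure.bind_apply (measurable_ofColoring hS) measurable_infinitePi_colorLaw.aemeasurable,
    paintboxMixture, Measure.bind_apply hS measurable_paintbox.aemeasurable]
  simp only [paintbox, Measure.map_apply measurable_ofColoring hS]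

/-- The law obtained by permuting the colors uniformly at random. -/
def symmetrizeColors {k : ℕ} (N : Measure (ℕ → Fin k)) : Measure (ℕ → Fin k) :=
  (k ! : ℝ≥0∞)⁻¹ • ∑ σ : Equiv.Perm (Fin k), N.map fun y i => σ (y i)

theorem measurable_recolor {k : ℕ} (σ : Equiv.Perm (Fin k)) :
    Measurable fun (y : ℕ → Fin k) i => σ (y i) :=
  measurable_pi_lambda _ fun i => (measurable_of_finite σ).comp (measurable_pi_apply i)

instance {k : ℕ} (N : Measure (ℕ → Fin k)) [IsProbabilityMeasure N] :
    IsProbabilityMeasure (symmetrizeColors N) := by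
  constructor
  have (σ : Equiv.Perm (Fin k)) : N.map (fun y i => σ (y i)) univ = 1 := by
    rw [Measure.map_apply (measurable_recolor σ) MeasurableSet.univ]
    simp
  simp only [symmetrizeColors, Measure.coe_smul, Measure.coe_finsetSum, Pi.smul_apply,
    Finset.sum_apply, this, smul_eq_mul, Finset.sum_const, Finset.card_univ, Fintype.card_perm,
    Fintype.card_fin, nsmul_eq_mul, mul_one]
  exact ENNReal.inv_mul_cancel (by exact_mod_cast (Nat.factorial_pos k).ne')
    (ENNReal.natCast_ne_top _)

theorem measurableSet_of_fintype_coords {k : ℕ} {β : Type*} [Finite β] (f : β → ℕ)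
    (S : Set (β → Fin k)) : MeasurableSet {y : ℕ → Fin k | (fun i => y (f i)) ∈ S} :=
  (measurable_pi_lambda _ fun i => measurable_pi_apply (f i)) (Set.toFinite S).measurableSet

/-- If `y` has the same level sets as `x` on `b`, then `(k - #)!` of the `k!` permutations turn `y`
into `x` there, with `#` the number of colors of `x` on `b`; otherwise none does. Integrating this
count gives the block factor of `p_n`. -/
theorem symmetrizeColors_real {k n : ℕ} (N : Measure (ℕ → Fin k)) (b : Set (Fin n))
    (x : Fin n → Fin k) :
    (symmetrizeColors N).real {y | ∀ i ∈ b, y i = x i} =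
      ((k - (PartitionAtMost.ofColoring x).numBlocksOn b)! : ℝ) / (k ! : ℝ) *
        N.real {y | ∀ i ∈ b, ∀ j ∈ b, y i = y j ↔ x i = x j} := by
  have hx (y : ℕ → Fin k) : (∀ i ∈ b, y i = x i) ↔ (fun i : b => y i) = fun i : b => x i := by
    simp [funext_iff]
  have hker (y : ℕ → Fin k) : (∀ i ∈ b, ∀ j ∈ b, y i = y j ↔ x i = x j) ↔
      Setoid.ker (fun i : b => y i) = Setoid.ker fun i : b => x i := by
    simp [Setoid.ext_iff, Setoid.ker_def]
  have hm (σ : Equiv.Perm (Fin k)) :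
      MeasurableSet {y : ℕ → Fin k | ⇑σ ∘ (fun i : b => y i) = fun i : b => x i} :=
    measurableSet_of_fintype_coords (fun i : b => (i : ℕ)) {y | ⇑σ ∘ y = fun i : b => x i}
  have hm0 : MeasurableSet {y : ℕ → Fin k | (fun i : b => y i) = fun i : b => x i} :=
    measurableSet_of_fintype_coords (fun i : b => (i : ℕ)) {y | y = fun i : b => x i}
  have hm2 : MeasurableSet {y : ℕ → Fin k |
      Setoid.ker (fun i : b => y i) = Setoid.ker fun i : b => x i} :=
    measurableSet_of_fintype_coords (fun i : b => (i : ℕ))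
      {y | Setoid.ker y = Setoid.ker fun i : b => x i}
  simp only [hx, hker, PartitionAtMost.numBlocksOn_ofColoring]
  have key : ∑ σ : Equiv.Perm (Fin k), N {y | ⇑σ ∘ (fun i : b => y i) = fun i : b => x i} =
      ((k - (range fun i : b => x i).ncard)! : ℝ≥0∞) *
        N {y | Setoid.ker (fun i : b => y i) = Setoid.ker fun i : b => x i} := by
    rw [← lintegral_indicator_one hm2, ← lintegral_const_mul _ (measurable_one.indicator hm2),
      Finset.sum_congr rfl fun σ _ => (lintegral_indicator_one (hm σ)).symm,
      ← lintegral_finsetSum _ fun σ _ => measurable_one.indicator (hm σ)]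
    refine lintegral_congr fun y => ?_
    have := sum_perm_indicator_comp_eq (fun i : b => x i) (fun i : b => y i)
    rw [Fintype.card_fin] at this
    exact this
  have hs : (symmetrizeColors N) {y | (fun i : b => y i) = fun i : b => x i} =
      (k ! : ℝ≥0∞)⁻¹ * (((k - (range fun i : b => x i).ncard)! : ℝ≥0∞) *
        N {y | Setoid.ker (fun i : b => y i) = Setoid.ker fun i : b => x i}) := by
    rw [← key]
    simp only [symmetrizeColors, Measure.coe_smul, Measure.coe_finsetSum, Pi.smul_apply,
      Finset.sum_apply, smul_eq_mul]
    congr 1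
    refine Finset.sum_congr rfl fun σ _ => ?_
    rw [Measure.map_apply (measurable_recolor σ) hm0]
    rfl
  simp only [Measure.real, hs, ENNReal.toReal_mul, ENNReal.toReal_inv, ENNReal.toReal_natCast]
  ring

theorem symmetrizeColors_iidColorMixture_real {k n : ℕ} (ν : Measure (RankedSimplex k))
    (b : Set (Fin n)) (x : Fin n → Fin k) :
    (symmetrizeColors (iidColorMixture ν)).real {y | ∀ i ∈ b, y i = x i} =
      ((k - (PartitionAtMost.ofColoring x).numBlocksOn b)! : ℝ) / (k ! : ℝ) *
        paintboxProbOn ν (PartitionAtMost.ofColoring x) b := by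
  rw [symmetrizeColors_real, paintboxProbOn, ← map_iidColorMixture, measureReal_def,
    measureReal_def, Measure.map_apply measurable_ofColoring]
  · rfl
  · have : {C : PartitionAtMost ℕ k | ∀ i ∈ b, ∀ j ∈ b,
        C.1 i j ↔ (PartitionAtMost.ofColoring x).1 i j} = ⋂ i ∈ b, ⋂ j ∈ b,
          {C : PartitionAtMost ℕ k | C.1 i j ↔ (PartitionAtMost.ofColoring x).1 i j} := by
      ext; simp
    rw [this]
    refine MeasurableSet.biInter b.to_countable fun i _ =>
      MeasurableSet.biInter b.to_countable fun j _ => ?_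
    by_cases h : (PartitionAtMost.ofColoring x).1 i j
    · simpa [h] using PartitionAtMost.measurableSet_rel (k := k) i j
    · simp only [h, iff_false]
      exact (PartitionAtMost.measurableSet_rel (k := k) i j).compl

/-! ### The chain kernel on partitions of `ℕ` -/

namespace PartitionAtMost

variable {k : ℕ}

/-- The least element of the block of `i`. -/
def rep (A : PartitionAtMost ℕ k) (i : ℕ) : ℕ := sInf {j | A.1 j i}

theorem rel_rep (A : PartitionAtMost ℕ k) (i : ℕ) : A.1 (A.rep i) i :=
  Nat.sInf_mem (s := {j | A.1 j i}) ⟨i, A.1.refl i⟩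

theorem rep_eq_rep_iff (A : PartitionAtMost ℕ k) {i j : ℕ} : A.rep i = A.rep j ↔ A.1 i j := by
  constructor
  · intro h
    exact A.1.trans (A.1.symm (A.rel_rep i)) (h ▸ A.rel_rep j)
  · intro h
    unfold rep
    congr 1
    ext l
    exact ⟨fun hl => A.1.trans hl h, fun hl => A.1.trans hl (A.1.symm h)⟩

theorem measurable_rep (i : ℕ) : Measurable fun A : PartitionAtMost ℕ k => A.rep i := by
  refine measurable_to_countable' fun m => ?_
  have : (fun A : PartitionAtMost ℕ k => A.rep i) ⁻¹' {m} =
      {A | A.1 m i} ∩ ⋂ j ∈ Iio m, {A | A.1 j i}ᶜ := by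
    ext A
    simp only [mem_preimage, mem_singleton_iff, mem_inter_iff, mem_ofPred_eq, mem_iInter,
      mem_compl_iff, mem_Iio]
    constructor
    · rintro rfl
      exact ⟨A.rel_rep i, fun j hj => Nat.notMem_of_lt_sInf (s := {j | A.1 j i}) hj⟩
    · rintro ⟨h1, h2⟩
      refine le_antisymm (Nat.sInf_le h1) (not_lt.1 fun h => h2 _ h (A.rel_rep i))
  rw [this]
  exact (measurableSet_rel m i).inter
    (MeasurableSet.biInter (to_countable _) fun j _ => (measurableSet_rel j i).compl)

open Classical in
theorem blocks_restrict (A : PartitionAtMost ℕ k) (n : ℕ) :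
    (A.restrict n).blocks = (Finset.univ.image fun i : Fin n => A.rep i).image
      fun r => {i : Fin n | A.rep i = r} := by
  ext b
  simp only [blocks, Finite.mem_toFinset, Finset.image_image, Finset.mem_image, Finset.mem_univ,
    true_and, Function.comp_apply]
  refine exists_congr fun j => ?_
  rw [eq_comm]
  refine Eq.congr_left ?_
  ext i
  exact (rep_eq_rep_iff A).symm

/-- A block is named by its least element, so one array of colorings indexed by `ℕ` serves all
partitions: the point `i` takes its color from row `rep i`. -/
theorem measurable_recolorBlocks : Measurable
    fun (q : PartitionAtMost ℕ k × (ℕ → ℕ → Fin k)) (i : ℕ) => q.2 (q.1.rep i) i := by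
  refine measurable_pi_lambda _ fun i => ?_
  have h : Measurable fun q : ℕ × (ℕ → ℕ → Fin k) => q.2 q.1 i :=
    measurable_from_prod_countable_right fun m =>
      (measurable_pi_apply i).comp (measurable_pi_apply m)
  exact h.comp (((measurable_rep i).comp measurable_fst).prodMk measurable_snd)

/-- Color the blocks of a partition by independent colorings with law `M`. -/
def coloringKernel (M : Measure (ℕ → Fin k)) [IsProbabilityMeasure M] :
    Kernel (PartitionAtMost ℕ k) (ℕ → Fin k) :=
  (Kernel.id ×ₖ Kernel.const _ (Measure.infinitePi fun _ : ℕ => M)).map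
    fun q i => q.2 (q.1.rep i) i

instance (M : Measure (ℕ → Fin k)) [IsProbabilityMeasure M] :
    IsMarkovKernel (coloringKernel M) :=
  Kernel.IsMarkovKernel.map _ measurable_recolorBlocks

theorem coloringKernel_apply (M : Measure (ℕ → Fin k)) [IsProbabilityMeasure M]
    (A : PartitionAtMost ℕ k) {S : Set (ℕ → Fin k)} (hS : MeasurableSet S) :
    coloringKernel M A S =
      (Measure.infinitePi fun _ : ℕ => M) {Y | (fun i => Y (A.rep i) i) ∈ S} := by
  rw [coloringKernel, Kernel.map_apply' _ measurable_recolorBlocks _ hS, Kernel.prod_apply,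
    Kernel.id_apply, Kernel.const_apply, Measure.dirac_prod,
    Measure.map_apply measurable_prodMk_left (measurable_recolorBlocks hS)]
  rfl

/-- Distinct blocks read distinct rows of the array, and the rows are independent. -/
theorem coloringKernel_real (M : Measure (ℕ → Fin k)) [IsProbabilityMeasure M]
    (A : PartitionAtMost ℕ k) {n : ℕ} (x : Fin n → Fin k) :
    (coloringKernel M A).real {y | (fun i : Fin n => y i) = x} =
      ∏ b ∈ (A.restrict n).blocks, M.real {y | ∀ i ∈ b, y i = x i} := by
  classical
  have hm (b : Set (Fin n)) : MeasurableSet {y : ℕ → Fin k | ∀ i ∈ b, y i = x i} := by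
    simpa using measurableSet_of_fintype_coords (fun i : Fin n => (i : ℕ)) {y | ∀ i ∈ b, y i = x i}
  rw [measureReal_def, coloringKernel_apply M A (S := {y | (fun i : Fin n => y i) = x})
    (measurableSet_of_fintype_coords (fun i : Fin n => (i : ℕ)) {y | y = x})]
  have : {Y : ℕ → ℕ → Fin k | (fun i => Y (A.rep i) i) ∈
      {y : ℕ → Fin k | (fun i : Fin n => y i) = x}} =
      Set.pi (Finset.univ.image fun i : Fin n => A.rep i)
        fun r => {y : ℕ → Fin k | ∀ i ∈ {i : Fin n | A.rep i = r}, y i = x i} := by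
    ext Y
    simp only [mem_ofPred_eq, funext_iff, Finset.coe_image, Finset.coe_univ, image_univ, mem_pi,
      forall_mem_range]
    exact ⟨fun h j i hi => hi ▸ h i, fun h i => h i i rfl⟩
  rw [this, Measure.infinitePi_pi _ fun r _ => hm _, ENNReal.toReal_prod, blocks_restrict]
  refine (Finset.prod_image (s := Finset.univ.image fun i : Fin n => A.rep i)
    (g := fun r => {i : Fin n | A.rep i = r})
    (f := fun b => M.real {y | ∀ i : Fin n, i ∈ b → y i = x i}) ?_).symm.trans ?_
  rotate_left
  · congr
  · simp only [Finset.coe_image, Finset.coe_univ, image_univ]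
    rintro _ ⟨i, rfl⟩ _ ⟨j, rfl⟩ h
    exact (Set.ext_iff.1 h i).1 rfl

/-- The transition kernel of the chain: color the blocks independently by relabeled paintboxes. -/
def chainKernel (ν : Measure (RankedSimplex k)) [IsProbabilityMeasure ν] :
    Kernel (PartitionAtMost ℕ k) (PartitionAtMost ℕ k) :=
  (coloringKernel (symmetrizeColors (iidColorMixture ν))).map ofColoring

instance (ν : Measure (RankedSimplex k)) [IsProbabilityMeasure ν] :
    IsMarkovKernel (chainKernel ν) :=
  Kernel.IsMarkovKernel.map _ measurable_ofColoring

/-- All colorings of `B'` are equally likely, with probability the product over blocks in `p_n`;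
their number is the prefactor. -/
theorem isChainKernel_chainKernel (ν : Measure (RankedSimplex k)) [IsProbabilityMeasure ν] :
    IsChainKernel ν (chainKernel ν) := by
  classical
  refine ⟨inferInstance, fun n A B' => ?_⟩
  rw [chainKernel, Kernel.map_apply _ measurable_ofColoring, measureReal_def,
    Measure.map_apply measurable_ofColoring (measurableSet_restrict_eq n B')]
  have : ofColoring ⁻¹' {A' : PartitionAtMost ℕ k | A'.restrict n = B'} =
      ⋃ x ∈ Finset.univ.filter (fun x : Fin n → Fin k => ofColoring x = B'),
        {y : ℕ → Fin k | (fun i : Fin n => y i) = x} := by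
    ext y
    simp [restrict_ofColoring]
  rw [this, ← measureReal_def, measureReal_biUnion_finset
    (f := fun x : Fin n → Fin k => {y : ℕ → Fin k | (fun i : Fin n => y i) = x})
    (fun x _ y _ hxy => Set.disjoint_left.2 fun z hz hz' => hxy (hz.symm.trans hz'))
    (fun x _ => measurableSet_of_fintype_coords (fun i : Fin n => (i : ℕ)) {y | y = x})]
  rw [transitionProb, ← card_colorings, ← nsmul_eq_mul, ← Finset.sum_const]
  refine Finset.sum_congr (by congr) fun x hx => ?_
  rw [coloringKernel_real]
  refine Finset.prod_congr rfl fun b _ => ?_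
  rw [symmetrizeColors_iidColorMixture_real, (Finset.mem_filter.1 hx).2]

end PartitionAtMost

open scoped Matrix



/-! ### Kernel powers and finite-dimensional marginals -/

namespace ProbabilityTheory.Kernel

theorem isMarkovKernel_pow {α : Type*} [MeasurableSpace α] (κ : Kernel α α) [IsMarkovKernel κ]
    (j : ℕ) : IsMarkovKernel (κ ^ j) := by
  induction j with
  | zero => exact inferInstanceAs (IsMarkovKernel Kernel.id)
  | succ j ih => exact inferInstanceAs (IsMarkovKernel ((κ ^ j) ∘ₖ κ))

theorem pow_succ_apply' {α : Type*} [MeasurableSpace α] (κ : Kernel α α) (j : ℕ) (a : α) :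
    (κ ^ (j + 1)) a = ((κ ^ j) a).bind κ := by
  rw [pow_succ']
  exact Kernel.comp_apply κ (κ ^ j) a

end ProbabilityTheory.Kernel

namespace PartitionAtMost

variable {k : ℕ}

/-- The law of the restriction to `[n]`, as a vector of probabilities. -/
def marginal (μ : Measure (PartitionAtMost ℕ k)) (n : ℕ) : PartitionAtMost (Fin n) k → ℝ :=
  fun B => μ.real {A | A.restrict n = B}

theorem marginal_nonneg (μ : Measure (PartitionAtMost ℕ k)) (n : ℕ)
    (B : PartitionAtMost (Fin n) k) : 0 ≤ marginal μ n B := measureReal_nonneg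

theorem sum_marginal (μ : Measure (PartitionAtMost ℕ k)) [IsProbabilityMeasure μ] (n : ℕ) :
    ∑ B, marginal μ n B = 1 := by
  simp only [marginal]
  rw [← measureReal_biUnion_finset
    (f := fun B : PartitionAtMost (Fin n) k => {A : PartitionAtMost ℕ k | A.restrict n = B})
    (fun B _ B' _ h => Set.disjoint_left.2 fun z hz hz' => h (hz.symm.trans hz'))
    (fun B _ => measurableSet_restrict_eq n B)]
  have : ⋃ B ∈ (Finset.univ : Finset (PartitionAtMost (Fin n) k)),
      {A : PartitionAtMost ℕ k | A.restrict n = B} = univ := by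
    ext A
    simp
  rw [this, probReal_univ]

theorem marginal_le_one (μ : Measure (PartitionAtMost ℕ k)) [IsProbabilityMeasure μ] (n : ℕ)
    (B : PartitionAtMost (Fin n) k) : marginal μ n B ≤ 1 := measureReal_le_one

theorem bind_real_eq_sum {Ω : Type*} [MeasurableSpace Ω] (μ : Measure (PartitionAtMost ℕ k))
    (κ : Kernel (PartitionAtMost ℕ k) Ω) [IsFiniteMeasure μ] [IsFiniteKernel κ] {D : Set Ω}
    (hD : MeasurableSet D) (n : ℕ) (f : PartitionAtMost (Fin n) k → ℝ)
    (h : ∀ A, (κ A).real D = f (A.restrict n)) :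
    (μ.bind κ).real D = ∑ B, marginal μ n B * f B := by
  let _ : MeasurableSpace (PartitionAtMost (Fin n) k) := ⊤
  have hr : Measurable (restrict n : PartitionAtMost ℕ k → _) := measurable_restrict n
  have h' (A : PartitionAtMost ℕ k) : κ A D = ENNReal.ofReal (f (A.restrict n)) := by
    rw [← h, ofReal_measureReal]
  rw [measureReal_def, Measure.bind_apply hD κ.aemeasurable]
  simp only [h']
  rw [← lintegral_map (f := fun B => ENNReal.ofReal (f B)) (measurable_of_finite _) hr,
    lintegral_fintype, ENNReal.toReal_sum]
  · refine Finset.sum_congr rfl fun B _ => ?_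
    rw [Measure.map_apply hr (MeasurableSet.singleton B), ENNReal.toReal_mul]
    change _ * μ.real {A | A.restrict n = B} = _
    rw [mul_comm, marginal]
    -- `f` is controlled only at restrictions of partitions of `ℕ`; elsewhere its value is
    -- irrelevant because the marginal vanishes.
    by_cases hB : ∃ A : PartitionAtMost ℕ k, A.restrict n = B
    · obtain ⟨A, rfl⟩ := hB
      rw [ENNReal.toReal_ofReal (h A ▸ measureReal_nonneg)]
    · have : {A : PartitionAtMost ℕ k | A.restrict n = B} = ∅ :=
        eq_empty_of_forall_notMem fun A hA => hB ⟨A, hA⟩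
      simp [this]
  · intro B _
    exact ENNReal.mul_ne_top ENNReal.ofReal_ne_top (measure_ne_top _ _)

/-- This reduces invariance on `ℕ` to a row-vector equation for each `n`. -/
theorem marginal_bind {μ : Measure (PartitionAtMost ℕ k)} [IsFiniteMeasure μ]
    {κ : Kernel (PartitionAtMost ℕ k) (PartitionAtMost ℕ k)} [IsFiniteKernel κ] {n : ℕ}
    {K : Matrix (PartitionAtMost (Fin n) k) (PartitionAtMost (Fin n) k) ℝ}
    (h : ∀ A, marginal (κ A) n = K (A.restrict n)) :
    marginal (μ.bind κ) n = marginal μ n ᵥ* K := by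
  ext B'
  exact bind_real_eq_sum μ κ (measurableSet_restrict_eq n B') n (fun B => K B B')
    fun A => congrFun (h A) B'

theorem marginal_ext {μ μ' : Measure (PartitionAtMost ℕ k)} [IsProbabilityMeasure μ]
    [IsProbabilityMeasure μ'] (h : ∀ n, marginal μ n = marginal μ' n) : μ = μ' :=
  measure_ext fun n B => congrFun (h n) B

/-- The matrix with entries `transitionProb ν B B'`. -/
def transitionMatrix (ν : Measure (RankedSimplex k)) (n : ℕ) :
    Matrix (PartitionAtMost (Fin n) k) (PartitionAtMost (Fin n) k) ℝ :=
  Matrix.of (transitionProb ν)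

theorem marginal_chainKernel (ν : Measure (RankedSimplex k)) [IsProbabilityMeasure ν] (n : ℕ)
    (A : PartitionAtMost ℕ k) :
    marginal (chainKernel ν A) n = transitionMatrix ν n (A.restrict n) :=
  funext fun B' => (isChainKernel_chainKernel ν).restrict_eq n A B'

theorem marginal_pow {κ : Kernel (PartitionAtMost ℕ k) (PartitionAtMost ℕ k)} [IsMarkovKernel κ]
    {n : ℕ} {K : Matrix (PartitionAtMost (Fin n) k) (PartitionAtMost (Fin n) k) ℝ}
    (h : ∀ A, marginal (κ A) n = K (A.restrict n)) (j : ℕ) (A : PartitionAtMost ℕ k) :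
    marginal ((κ ^ j) A) n = (K ^ j) (A.restrict n) := by
  induction j with
  | zero =>
    ext B
    rw [pow_zero, pow_zero]
    change (Kernel.id A).real _ = _
    rw [Kernel.id_apply, measureReal_def, Measure.dirac_apply' _ (measurableSet_restrict_eq n B)]
    by_cases hB : A.restrict n = B <;> simp [Matrix.one_apply, hB]
  | succ j ih =>
    have := Kernel.isMarkovKernel_pow κ j
    rw [Kernel.pow_succ_apply', marginal_bind h, ih, pow_succ]
    rfl

end PartitionAtMost

/-! ### Poissonization and the continuous-time semigroup -/

theorem Matrix.hasSum_exp {m : Type*} [Fintype m] [DecidableEq m] (A : Matrix m m ℝ) :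
    HasSum (fun j : ℕ => ((j ! : ℝ)⁻¹) • A ^ j) (NormedSpace.exp A) := by
  let _ : NormedRing (Matrix m m ℝ) := Matrix.linftyOpNormedRing
  let _ : NormedAlgebra ℝ (Matrix m m ℝ) := Matrix.linftyOpNormedAlgebra
  exact NormedSpace.exp_series_hasSum_exp' A

theorem Matrix.exp_smul_one {m : Type*} [Fintype m] [DecidableEq m] (c : ℝ) :
    NormedSpace.exp (c • (1 : Matrix m m ℝ)) = Real.exp c • 1 := by
  rw [← Matrix.diagonal_one, ← Matrix.diagonal_smul, Matrix.exp_diagonal, ← Matrix.diagonal_smul]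
  congr 1
  ext i
  rw [Pi.coe_exp, Real.exp_eq_exp_ℝ]
  simp

/-- The identity commutes with `P`, so the exponential splits as `e^{-c} exp (c P)`: a Poisson(`c`)
mixture of powers. -/
theorem Matrix.hasSum_exp_smul_sub_one {m : Type*} [Fintype m] [DecidableEq m] (c : ℝ)
    (P : Matrix m m ℝ) (a b : m) :
    HasSum (fun j : ℕ => Real.exp (-c) * c ^ j / (j ! : ℝ) * (P ^ j) a b)
      (NormedSpace.exp (c • (P - 1)) a b) := by
  have h1 : NormedSpace.exp (c • (P - 1)) = Real.exp (-c) • NormedSpace.exp (c • P) := by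
    have : c • (P - 1) = c • P + (-c) • (1 : Matrix m m ℝ) := by
      rw [smul_sub, neg_smul, sub_eq_add_neg]
    rw [this, Matrix.exp_add_of_commute, Matrix.exp_smul_one, mul_smul_comm, mul_one]
    exact (Commute.one_right _).smul_right _
  have h2 := Pi.hasSum.1 (Pi.hasSum.1 (Matrix.hasSum_exp (c • P)) a) b
  rw [h1, Matrix.smul_apply, smul_eq_mul]
  have h3 := h2.mul_left (Real.exp (-c))
  refine Eq.subst (motive := fun f => HasSum f _) (funext fun j => ?_) h3
  rw [smul_pow]
  simp only [Matrix.smul_apply, smul_eq_mul]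
  ring

theorem hasSum_poisson_weights (c : ℝ) :
    HasSum (fun j : ℕ => Real.exp (-c) * c ^ j / (j ! : ℝ)) 1 := by
  have := (NormedSpace.expSeries_div_hasSum_exp c).mul_left (Real.exp (-c))
  rw [← Real.exp_eq_exp_ℝ, ← Real.exp_add, neg_add_cancel, Real.exp_zero] at this
  simpa only [mul_div_assoc] using this

namespace ProbabilityTheory.Kernel

variable {α : Type*} [MeasurableSpace α]

/-- The kernel `κ` iterated a Poisson number of times. -/
def poissonIterate (c : ℝ) (κ : Kernel α α) : Kernel α α where
  toFun a := Measure.sum fun j : ℕ => ENNReal.ofReal (Real.exp (-c) * c ^ j / (j ! : ℝ)) • (κ ^ j) a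
  measurable' := by
    refine Measure.measurable_of_measurable_coe _ fun s hs => ?_
    simp only [Measure.sum_apply _ hs, Measure.smul_apply, smul_eq_mul]
    exact Measurable.tsum fun j => ((κ ^ j).measurable_coe hs).const_mul _

theorem poissonIterate_apply (c : ℝ) (κ : Kernel α α) (a : α) {s : Set α} (hs : MeasurableSet s) :
    poissonIterate c κ a s =
      ∑' j : ℕ, ENNReal.ofReal (Real.exp (-c) * c ^ j / (j ! : ℝ)) * (κ ^ j) a s :=
  Measure.sum_apply _ hs

theorem tsum_ofReal_poisson_weights {c : ℝ} (hc : 0 ≤ c) :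
    ∑' j : ℕ, ENNReal.ofReal (Real.exp (-c) * c ^ j / (j ! : ℝ)) = 1 := by
  rw [← ENNReal.ofReal_tsum_of_nonneg (fun j => by positivity) (hasSum_poisson_weights c).summable,
    (hasSum_poisson_weights c).tsum_eq, ENNReal.ofReal_one]

theorem isMarkovKernel_poissonIterate {c : ℝ} (hc : 0 ≤ c) (κ : Kernel α α) [IsMarkovKernel κ] :
    IsMarkovKernel (poissonIterate c κ) := by
  refine ⟨fun a => ⟨?_⟩⟩
  rw [poissonIterate_apply _ _ _ MeasurableSet.univ, ← tsum_ofReal_poisson_weights hc]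
  refine tsum_congr fun j => ?_
  have := isMarkovKernel_pow κ j
  rw [measure_univ, mul_one]

theorem poissonIterate_real {c : ℝ} (hc : 0 ≤ c) (κ : Kernel α α) [IsMarkovKernel κ] (a : α)
    {s : Set α} (hs : MeasurableSet s) :
    (poissonIterate c κ a).real s =
      ∑' j : ℕ, Real.exp (-c) * c ^ j / (j ! : ℝ) * ((κ ^ j) a).real s := by
  have (j : ℕ) := isMarkovKernel_pow κ j
  rw [measureReal_def, poissonIterate_apply _ _ _ hs, ENNReal.tsum_toReal_eq]
  · refine tsum_congr fun j => ?_
    rw [ENNReal.toReal_mul, ENNReal.toReal_ofReal (by positivity), measureReal_def]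
  · exact fun j => ENNReal.mul_ne_top ENNReal.ofReal_ne_top (measure_ne_top _ _)

theorem Invariant.pow {κ : Kernel α α} {μ : Measure α} (h : κ.Invariant μ) (j : ℕ) :
    (κ ^ j).Invariant μ := by
  induction j with
  | zero => exact Measure.id_comp
  | succ j ih => exact ih.comp h

theorem Invariant.poissonIterate {c : ℝ} (hc : 0 ≤ c) {κ : Kernel α α} {μ : Measure α}
    (h : κ.Invariant μ) : (poissonIterate c κ).Invariant μ := by
  ext s hs
  rw [Measure.bind_apply hs (Kernel.aemeasurable _)]
  simp only [poissonIterate_apply _ _ _ hs]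
  rw [lintegral_tsum fun j => (((κ ^ j).measurable_coe hs).const_mul _).aemeasurable]
  have hj (j : ℕ) : ∫⁻ a, (κ ^ j) a s ∂μ = μ s := by
    rw [← Measure.bind_apply hs (Kernel.aemeasurable _), (h.pow j).def]
  simp only [lintegral_const_mul _ ((κ ^ _).measurable_coe hs), hj]
  rw [ENNReal.tsum_mul_right, tsum_ofReal_poisson_weights hc, one_mul]

end ProbabilityTheory.Kernel

namespace PartitionAtMost

variable {k : ℕ}

theorem rateMatrix_eq (rate : ℝ) (ν : Measure (RankedSimplex k)) (n : ℕ) :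
    rateMatrix rate ν n = rate • (transitionMatrix ν n - 1) := by
  ext B B'
  rw [rateMatrix, Matrix.smul_apply, Matrix.sub_apply, Matrix.one_apply, transitionMatrix,
    Matrix.of_apply, smul_eq_mul]
  split_ifs with h
  · rw [h]
  · rw [sub_zero]

theorem hasSum_exp_rateMatrix (rate t : ℝ) (ν : Measure (RankedSimplex k)) (n : ℕ)
    (B B' : PartitionAtMost (Fin n) k) :
    HasSum (fun j : ℕ => Real.exp (-(t * rate)) * (t * rate) ^ j / (j ! : ℝ) *
      (transitionMatrix ν n ^ j) B B') (NormedSpace.exp (t • rateMatrix rate ν n) B B') := by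
  rw [rateMatrix_eq, smul_smul]
  exact Matrix.hasSum_exp_smul_sub_one _ _ _ _

/-- The transition semigroup: the chain run at the jump times of a Poisson process. -/
def semigroup (rate : ℝ) (ν : Measure (RankedSimplex k)) [IsProbabilityMeasure ν] (t : ℝ≥0) :
    Kernel (PartitionAtMost ℕ k) (PartitionAtMost ℕ k) :=
  Kernel.poissonIterate (t * rate) (chainKernel ν)

theorem isRhoMarkovSemigroup_semigroup {rate : ℝ} (hr : 0 ≤ rate) (ν : Measure (RankedSimplex k))
    [IsProbabilityMeasure ν] : IsRhoMarkovSemigroup rate ν (semigroup rate ν) := by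
  refine ⟨fun t => Kernel.isMarkovKernel_poissonIterate (by positivity) _, fun t n A B' => ?_⟩
  rw [semigroup, Kernel.poissonIterate_real (by positivity) _ _ (measurableSet_restrict_eq n B'),
    ← (hasSum_exp_rateMatrix rate t ν n (A.restrict n) B').tsum_eq]
  refine tsum_congr fun j => ?_
  rw [← marginal_pow (marginal_chainKernel ν n) j A]
  rfl

end PartitionAtMost

/-! ### Uniqueness by a positive column -/

/-- A stochastic matrix with a strictly positive column has at most one stationary distribution. -/
theorem Matrix.eq_of_vecMul_eq_of_pos_column {m : Type*} [Fintype m] {K : Matrix m m ℝ}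
    (h0 : ∀ a b, 0 ≤ K a b) (h1 : ∀ a, ∑ b, K a b = 1) {e : m} (he : ∀ a, 0 < K a e)
    {u v : m → ℝ} (huv : ∑ a, u a = ∑ a, v a) (hu : u ᵥ* K = u) (hv : v ᵥ* K = v) : u = v := by
  classical
  set d : m → ℝ := u - v
  have hd : d ᵥ* K = d := by rw [Matrix.sub_vecMul, hu, hv]
  have hd0 : ∑ a, d a = 0 := by simp [d, huv]
  obtain ⟨a₀, ha₀⟩ : ∃ a₀, ∀ a, K a₀ e ≤ K a e := by
    have : Nonempty m := ⟨e⟩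
    exact Finite.exists_min fun a => K a e
  set ε := K a₀ e
  have hε : 0 < ε := he a₀
  -- Since `d` has total mass zero, lowering column `e` by the constant `ε` does not change `d K`.
  -- The lowered matrix is still nonnegative, with row sums `1 - ε`, hence a strict `ℓ¹`
  -- contraction.
  have key (b : m) : d b = ∑ a, d a * (K a b - if b = e then ε else 0) := by
    simp only [mul_sub, Finset.sum_sub_distrib, ← Finset.sum_mul, hd0, zero_mul, sub_zero]
    exact (congrFun hd b).symm
  have hle : ∑ b, |d b| ≤ ∑ a, |d a| * (1 - ε) := by
    calc ∑ b, |d b| ≤ ∑ b, ∑ a, |d a| * (K a b - if b = e then ε else 0) := by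
          refine Finset.sum_le_sum fun b _ => ?_
          rw [key b]
          refine (Finset.abs_sum_le_sum_abs _ _).trans (le_of_eq ?_)
          refine Finset.sum_congr rfl fun a _ => ?_
          rw [abs_mul, abs_of_nonneg (a := K a b - _)]
          split_ifs with hb
          · subst hb
            exact sub_nonneg.2 (ha₀ a)
          · simpa using h0 a b
      _ = ∑ a, |d a| * (1 - ε) := by
          rw [Finset.sum_comm]
          refine Finset.sum_congr rfl fun a _ => ?_
          rw [← Finset.mul_sum, Finset.sum_sub_distrib, h1]
          simp
  rw [← Finset.sum_mul] at hle
  have hs : ∑ b, |d b| = 0 := by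
    refine le_antisymm ?_ (Finset.sum_nonneg fun _ _ => abs_nonneg _)
    nlinarith
  funext a
  have := (Finset.sum_eq_zero_iff_of_nonneg fun b _ => abs_nonneg (d b)).1 hs a (Finset.mem_univ a)
  exact sub_eq_zero.1 (abs_eq_zero.1 this)

theorem RankedSimplex.pos_card {k : ℕ} (ν : Measure (RankedSimplex k)) [IsProbabilityMeasure ν] :
    0 < k := by
  obtain ⟨s⟩ := ν.nonempty_of_neZero
  rcases Nat.eq_zero_or_pos k with rfl | h
  · exact absurd s.2.2.2 (by simp)
  · exact h

theorem RankedSimplex.one_le_mul_head {k : ℕ} (hk : 0 < k) (s : RankedSimplex k) :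
    1 ≤ k * s.1 ⟨0, hk⟩ := by
  calc (1 : ℝ) = ∑ i, s.1 i := s.2.2.2.symm
    _ ≤ ∑ _i : Fin k, s.1 ⟨0, hk⟩ := Finset.sum_le_sum fun i _ => s.2.1 (Nat.zero_le _)
    _ = _ := by simp

/-- The first color has mass at least the average `1/k`, so the probability is at least `k^{-n}`
uniformly in `s`. -/
theorem iidColorMixture_const_pos {k : ℕ} (hk : 0 < k) (ν : Measure (RankedSimplex k))
    [IsProbabilityMeasure ν] (n : ℕ) :
    0 < iidColorMixture ν (Set.pi (Finset.range n) fun _ => {⟨0, hk⟩}) := by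
  have hm : MeasurableSet (Set.pi (Finset.range n : Set ℕ) fun _ => {(⟨0, hk⟩ : Fin k)}) :=
    MeasurableSet.pi (Finset.range n).countable_toSet fun _ _ => MeasurableSet.singleton _
  rw [iidColorMixture, Measure.bind_apply hm measurable_infinitePi_colorLaw.aemeasurable]
  have hc (s : RankedSimplex k) : ENNReal.ofReal (1 / k) ^ n ≤
      (Measure.infinitePi fun _ : ℕ => colorLaw s)
        (Set.pi (Finset.range n) fun _ => {(⟨0, hk⟩ : Fin k)}) := by
    rw [Measure.infinitePi_pi _ fun _ _ => MeasurableSet.singleton _, Finset.prod_const,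
      Finset.card_range]
    refine pow_le_pow_left₀ (zero_le) ?_ n
    simp only [colorLaw, Measure.coe_finsetSum, Measure.coe_smul, Finset.sum_apply, Pi.smul_apply,
      smul_eq_mul]
    refine le_trans ?_ (Finset.single_le_sum (fun _ _ => zero_le) (Finset.mem_univ ⟨0, hk⟩))
    rw [Measure.dirac_apply_of_mem (mem_singleton _), mul_one]
    refine ENNReal.ofReal_le_ofReal ?_
    rw [div_le_iff₀ (by exact_mod_cast hk), mul_comm]
    exact RankedSimplex.one_le_mul_head hk s
  refine lt_of_lt_of_le ?_ (lintegral_mono hc)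
  rw [lintegral_const, measure_univ, mul_one]
  exact pos_iff_ne_zero.2 (pow_ne_zero n (ENNReal.ofReal_pos.2 (by positivity)).ne')

namespace PartitionAtMost

variable {k : ℕ}

/-- The partition with a single block. -/
def oneBlock (hk : 0 < k) (α : Type) : PartitionAtMost α k := ofColoring fun _ => ⟨0, hk⟩

theorem paintboxProbOn_oneBlock_pos (hk : 0 < k) (ν : Measure (RankedSimplex k))
    [IsProbabilityMeasure ν] {n : ℕ} (b : Set (Fin n)) :
    0 < paintboxProbOn ν (oneBlock hk (Fin n)) b := by
  refine ENNReal.toReal_pos ?_ (measure_ne_top _ _)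
  rw [← map_iidColorMixture]
  refine (lt_of_lt_of_le (iidColorMixture_const_pos hk ν n) ?_).ne'
  refine le_trans (measure_mono (t := ofColoring ⁻¹' {C : PartitionAtMost ℕ k |
    ∀ i ∈ b, ∀ j ∈ b, C.1 i j ↔ (oneBlock hk (Fin n)).1 i j}) fun y hy i _ j _ => ?_)
    (Measure.le_map_apply measurable_ofColoring.aemeasurable _)
  have hy' (i : Fin n) : y i = ⟨0, hk⟩ := hy i (by simp)
  change y i = y j ↔ _
  rw [hy' i, hy' j]
  exact iff_of_true rfl rfl

theorem transitionProb_oneBlock_pos (hk : 0 < k) (ν : Measure (RankedSimplex k))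
    [IsProbabilityMeasure ν] {n : ℕ} (B : PartitionAtMost (Fin n) k) :
    0 < transitionProb ν B (oneBlock hk (Fin n)) :=
  mul_pos (by positivity) (Finset.prod_pos fun b _ =>
    mul_pos (by positivity) (paintboxProbOn_oneBlock_pos hk ν b))

/-- If the restrictions to `[n]` of a family of Markov kernels are governed by stochastic matrices
with a positive column, then there is at most one stationary distribution. -/
theorem eq_of_marginal_vecMul_eq
    (K : ∀ n, Matrix (PartitionAtMost (Fin n) k) (PartitionAtMost (Fin n) k) ℝ) (hk : 0 < k)
    (κ : Kernel (PartitionAtMost ℕ k) (PartitionAtMost ℕ k)) [IsMarkovKernel κ]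
    (h : ∀ n A, marginal (κ A) n = K n (A.restrict n))
    (hpos : ∀ n B, 0 < K n B (oneBlock hk (Fin n)))
    {μ μ' : Measure (PartitionAtMost ℕ k)} [IsProbabilityMeasure μ] [IsProbabilityMeasure μ']
    (hμ : ∀ n, marginal μ n ᵥ* K n = marginal μ n)
    (hμ' : ∀ n, marginal μ' n ᵥ* K n = marginal μ' n) : μ = μ' := by
  refine marginal_ext fun n => ?_
  refine Matrix.eq_of_vecMul_eq_of_pos_column (K := K n) ?_ ?_ (hpos n) ?_ (hμ n) (hμ' n)
  -- Every state is a restriction, so each row of `K n` is the law of a restriction; this makes `K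
  -- n` stochastic.
  · intro B B'
    obtain ⟨A, rfl⟩ := restrict_surjective hk n B
    rw [← h]
    exact marginal_nonneg _ _ _
  · intro B
    obtain ⟨A, rfl⟩ := restrict_surjective hk n B
    rw [← h]
    exact sum_marginal _ _
  · rw [sum_marginal, sum_marginal]

theorem transitionMatrix_pow_nonneg (hk : 0 < k) (ν : Measure (RankedSimplex k))
    [IsProbabilityMeasure ν] (n j : ℕ) (B B' : PartitionAtMost (Fin n) k) :
    0 ≤ (transitionMatrix ν n ^ j) B B' := by
  obtain ⟨A, rfl⟩ := restrict_surjective hk n B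
  rw [← marginal_pow (marginal_chainKernel ν n) j A]
  exact marginal_nonneg _ _ _

theorem exp_rateMatrix_oneBlock_pos (hk : 0 < k) {rate t : ℝ} (hr : 0 < rate) (ht : 0 < t)
    (ν : Measure (RankedSimplex k)) [IsProbabilityMeasure ν] (n : ℕ)
    (B : PartitionAtMost (Fin n) k) :
    0 < NormedSpace.exp (t • rateMatrix rate ν n) B (oneBlock hk (Fin n)) := by
  have h := hasSum_exp_rateMatrix rate t ν n B (oneBlock hk (Fin n))
  -- The term of exactly one Poisson jump already suffices.
  refine lt_of_lt_of_le ?_ (le_hasSum h 1 fun j _ =>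
    mul_nonneg (by positivity) (transitionMatrix_pow_nonneg hk ν n j _ _))
  simp only [pow_one]
  exact mul_pos (by positivity) (show 0 < transitionProb ν B _ from
    transitionProb_oneBlock_pos hk ν B)

end PartitionAtMost

/-! ### Existence by compactness and Cesàro averages -/

open Filter Topology


namespace PartitionAtMost

variable {k : ℕ}

/-- The event depends on finitely many discrete coordinates. Its empty frontier is what lets weak
convergence pass to its probability. -/
theorem isClopen_restrict_ofColoring_eq (n : ℕ) (B : PartitionAtMost (Fin n) k) :
    IsClopen (ofColoring ⁻¹' {A : PartitionAtMost ℕ k | A.restrict n = B}) := by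
  have hc : Continuous fun (x : ℕ → Fin k) (i : Fin n) => x i := by fun_prop
  exact (isClopen_discrete {x : Fin n → Fin k | ofColoring x = B}).preimage hc

/-- Convergence of laws of colorings implies convergence of the restricted partition laws. -/
theorem tendsto_marginal_map_ofColoring {ι : Type*} {l : Filter ι}
    {ηs : ι → ProbabilityMeasure (ℕ → Fin k)} {η : ProbabilityMeasure (ℕ → Fin k)}
    (h : Tendsto ηs l (𝓝 η)) (n : ℕ) :
    Tendsto (fun i => marginal ((ηs i : Measure (ℕ → Fin k)).map ofColoring) n) l
      (𝓝 (marginal ((η : Measure (ℕ → Fin k)).map ofColoring) n)) := by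
  refine tendsto_pi_nhds.2 fun B => ?_
  simp only [marginal, measureReal_def,
    Measure.map_apply measurable_ofColoring (measurableSet_restrict_eq n B)]
  refine (ENNReal.tendsto_toReal (measure_ne_top _ _)).comp
    (ProbabilityMeasure.tendsto_measure_of_null_frontier_of_tendsto' h ?_)
  rw [(isClopen_restrict_ofColoring_eq n B).frontier_eq, measure_empty]

/-- The difference telescopes to `(v (N + 2) - v 1) / (N + 1)`. The averages start at index `1`
because only after one step does the law of the chain come from `coloringKernel`. -/
theorem tendsto_cesaro_vecMul_sub {m : Type*} [Fintype m] {K : Matrix m m ℝ} {v : ℕ → m → ℝ}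
    (hv : ∀ j, v (j + 1) = v j ᵥ* K) (h0 : ∀ j b, 0 ≤ v j b) (h1 : ∀ j b, v j b ≤ 1) :
    Tendsto (fun N : ℕ => ((N + 1 : ℝ)⁻¹ • ∑ j ∈ Finset.range (N + 1), v (j + 1)) ᵥ* K -
      (N + 1 : ℝ)⁻¹ • ∑ j ∈ Finset.range (N + 1), v (j + 1)) atTop (𝓝 0) := by
  have h (N : ℕ) : ((N + 1 : ℝ)⁻¹ • ∑ j ∈ Finset.range (N + 1), v (j + 1)) ᵥ* K -
      (N + 1 : ℝ)⁻¹ • ∑ j ∈ Finset.range (N + 1), v (j + 1) =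
        (N + 1 : ℝ)⁻¹ • (v (N + 1 + 1) - v (0 + 1)) := by
    rw [Matrix.smul_vecMul, Matrix.sum_vecMul, ← smul_sub, ← Finset.sum_sub_distrib,
      ← Finset.sum_range_sub (fun j => v (j + 1))]
    simp only [hv]
  simp only [h]
  refine tendsto_pi_nhds.2 fun b => ?_
  have hN := tendsto_one_div_add_atTop_nhds_zero_nat (𝕜 := ℝ)
  refine squeeze_zero_norm (fun N => ?_) hN
  rw [Pi.smul_apply, smul_eq_mul, norm_mul, one_div, Real.norm_of_nonneg (by positivity)]
  refine mul_le_of_le_one_right (by positivity) ?_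
  rw [Pi.sub_apply, Real.norm_eq_abs, abs_le]
  constructor <;> linarith [h0 (N + 1 + 1) b, h1 (N + 1 + 1) b, h0 (0 + 1) b, h1 (0 + 1) b]

/-- The coloring of the partition after `j + 1` steps of the chain started at one block. -/
def coloringAt (hk : 0 < k) (ν : Measure (RankedSimplex k)) [IsProbabilityMeasure ν] (j : ℕ) :
    Measure (ℕ → Fin k) :=
  ((chainKernel ν ^ j) (oneBlock hk ℕ)).bind
    (coloringKernel (symmetrizeColors (iidColorMixture ν)))

instance (hk : 0 < k) (ν : Measure (RankedSimplex k)) [IsProbabilityMeasure ν] (j : ℕ) :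
    IsProbabilityMeasure (coloringAt hk ν j) := by
  have := Kernel.isMarkovKernel_pow (chainKernel ν) j
  unfold coloringAt
  infer_instance

theorem map_coloringAt (hk : 0 < k) (ν : Measure (RankedSimplex k)) [IsProbabilityMeasure ν]
    (j : ℕ) : (coloringAt hk ν j).map ofColoring = (chainKernel ν ^ (j + 1)) (oneBlock hk ℕ) := by
  rw [Kernel.pow_succ_apply', coloringAt, chainKernel, Measure.map_comp _ _ measurable_ofColoring]

/-- The Cesàro averages of the laws of the colorings. -/
def cesaroColoring (hk : 0 < k) (ν : Measure (RankedSimplex k)) [IsProbabilityMeasure ν] (N : ℕ) :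
    ProbabilityMeasure (ℕ → Fin k) :=
  ⟨(N + 1 : ℝ≥0∞)⁻¹ • ∑ j ∈ Finset.range (N + 1), coloringAt hk ν j, ⟨by
    simp only [Measure.coe_smul, Measure.coe_finsetSum, Pi.smul_apply, Finset.sum_apply,
      measure_univ, smul_eq_mul, Finset.sum_const, Finset.card_range, nsmul_eq_mul, mul_one]
    push_cast
    exact ENNReal.inv_mul_cancel (by positivity)
      (ENNReal.add_ne_top.2 ⟨ENNReal.natCast_ne_top _, ENNReal.one_ne_top⟩)⟩⟩

theorem marginal_cesaroColoring (hk : 0 < k) (ν : Measure (RankedSimplex k))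
    [IsProbabilityMeasure ν] (N n : ℕ) :
    marginal ((cesaroColoring hk ν N : Measure (ℕ → Fin k)).map ofColoring) n =
      (N + 1 : ℝ)⁻¹ • ∑ j ∈ Finset.range (N + 1),
        marginal ((chainKernel ν ^ (j + 1)) (oneBlock hk ℕ)) n := by
  ext B
  simp only [← map_coloringAt, marginal, measureReal_def, Pi.smul_apply, Finset.sum_apply,
    Measure.map_apply measurable_ofColoring (measurableSet_restrict_eq n B), cesaroColoring,
    ProbabilityMeasure.coe_mk, Measure.coe_smul, Measure.coe_finsetSum, smul_eq_mul,
    ENNReal.toReal_mul, ENNReal.toReal_inv]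
  rw [ENNReal.toReal_sum fun _ _ => measure_ne_top _ _, ENNReal.toReal_add
    (ENNReal.natCast_ne_top _) ENNReal.one_ne_top, ENNReal.toReal_natCast, ENNReal.toReal_one]

theorem exists_invariant_chainKernel (ν : Measure (RankedSimplex k)) [IsProbabilityMeasure ν] :
    ∃ θ : Measure (PartitionAtMost ℕ k), IsProbabilityMeasure θ ∧ (chainKernel ν).Invariant θ := by
  have hk := RankedSimplex.pos_card ν
  have hpow := Kernel.isMarkovKernel_pow (chainKernel ν)
  -- Probability measures on the compact space `ℕ → Fin k` form a compact space, so a limit along a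
  -- nonprincipal ultrafilter exists without extracting a subsequence.
  obtain ⟨η, hη⟩ : ∃ η, Tendsto (cesaroColoring hk ν) (hyperfilter ℕ) (𝓝 η) :=
    ⟨_, ((hyperfilter ℕ).map (cesaroColoring hk ν)).le_nhds_lim⟩
  have hθ : IsProbabilityMeasure ((η : Measure (ℕ → Fin k)).map ofColoring) :=
    Measure.isProbabilityMeasure_map measurable_ofColoring.aemeasurable
  refine ⟨_, hθ, marginal_ext fun n => ?_⟩
  rw [marginal_bind (marginal_chainKernel ν n), ← sub_eq_zero]
  have h1 := tendsto_marginal_map_ofColoring hη n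
  have h2 := ((continuous_id.matrix_vecMul (continuous_const (y := transitionMatrix ν n))).sub
    continuous_id).continuousAt.tendsto.comp h1
  -- The defect of invariance of the averages tends both to that of the limit law and, by
  -- telescoping, to zero.
  refine tendsto_nhds_unique h2 ?_
  have h3 := tendsto_cesaro_vecMul_sub (K := transitionMatrix ν n)
    (v := fun j => marginal ((chainKernel ν ^ j) (oneBlock hk ℕ)) n)
    (fun j => by rw [Kernel.pow_succ_apply', marginal_bind (marginal_chainKernel ν n)])
    (fun j => marginal_nonneg _ n) (fun j => marginal_le_one _ n)
  refine (h3.mono_left Nat.hyperfilter_le_atTop).congr fun N => ?_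
  simp only [Function.comp_apply, marginal_cesaroColoring, id]
  rfl

end PartitionAtMost

/-! ### One-dimensional laws of the continuous-time process -/

namespace PartitionAtMost

variable {k : ℕ}

theorem marginal_map_process {Ω : Type*} [MeasurableSpace Ω] {rate : ℝ}
    {ν : Measure (RankedSimplex k)} {P : Measure Ω} [IsProbabilityMeasure P]
    {X : ℝ≥0 → Ω → PartitionAtMost ℕ k} (hX : IsRhoMarkovProcess rate ν P X) (t : ℝ≥0) (n : ℕ) :
    marginal (P.map (X t)) n =
      marginal (P.map (X 0)) n ᵥ* NormedSpace.exp ((t : ℝ) • rateMatrix rate ν n) := by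
  have hS (s : ℝ≥0) (B : PartitionAtMost (Fin n) k) :
      MeasurableSet {ω | (X s ω).restrict n = B} :=
    hX.measurable s (measurableSet_restrict_eq n B)
  have hmap (s : ℝ≥0) (B : PartitionAtMost (Fin n) k) :
      marginal (P.map (X s)) n B = P.real {ω | (X s ω).restrict n = B} := by
    rw [marginal, map_measureReal_apply (hX.measurable s) (measurableSet_restrict_eq n B)]
    rfl
  ext B'
  have hmarkov (B : PartitionAtMost (Fin n) k) :
      P.real ({ω | (X 0 ω).restrict n = B} ∩ {ω | (X t ω).restrict n = B'}) =
        marginal (P.map (X 0)) n B *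
          NormedSpace.exp ((t : ℝ) • rateMatrix rate ν n) B B' := by
    -- Only the two-point distribution at times `0` and `t` is needed; summing over the initial
    -- state gives the law at `t`.
    have h := hX.restrict_markov n 1 ![0, t] (by
      rw [Fin.monotone_iff_le_succ]
      intro i
      fin_cases i
      simp) ![B, B']
    simp only [Finset.univ_unique, Finset.prod_singleton] at h
    simpa [hmap, ofPred_and] using h
  change _ = ∑ B, _ * _
  rw [hmap, Finset.sum_congr rfl fun B _ => (hmarkov B).symm, ← measureReal_biUnion_finset
    (f := fun B : PartitionAtMost (Fin n) k =>
      {ω | (X 0 ω).restrict n = B} ∩ {ω | (X t ω).restrict n = B'})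
    (fun B _ C _ h => Set.disjoint_left.2 fun z hz hz' => h (hz.1.symm.trans hz'.1))
    (fun B _ => (hS 0 B).inter (hS t B'))]
  congr 1
  ext ω
  simp

end PartitionAtMost

end

/-! ### The stationary distribution -/

theorem corollary1 (k : ℕ) (ν : Measure (RankedSimplex k)) [IsProbabilityMeasure ν]
    (hν : ν (oneBlockMass k) < 1) :
    ∃ θ : Measure (PartitionAtMost ℕ k), IsProbabilityMeasure θ ∧
      -- `θ` is the unique stationary distribution of the discrete-time chain
      (∀ μ : Measure (PartitionAtMost ℕ k), IsProbabilityMeasure μ →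
        (IsStationaryForChain ν μ ↔ μ = θ)) ∧
      ∀ rate : ℝ, 0 < rate →
        -- `θ` is the unique stationary distribution of the continuous-time transition semigroup
        (∀ μ : Measure (PartitionAtMost ℕ k), IsProbabilityMeasure μ →
          (IsStationaryForSemigroup rate ν μ ↔ μ = θ)) ∧
        -- a continuous-time process has constant one-dimensional law iff it is started from `θ`
        (∀ {Ω : Type*} [MeasurableSpace Ω] (P : Measure Ω) [IsProbabilityMeasure P]
          (B : ℝ≥0 → Ω → PartitionAtMost ℕ k), IsRhoMarkovProcess rate ν P B →
          ((∀ t, P.map (B t) = P.map (B 0)) ↔ P.map (B 0) = θ)) := by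
  have hk := RankedSimplex.pos_card ν
  obtain ⟨θ, hθ, hinv⟩ := PartitionAtMost.exists_invariant_chainKernel ν
  refine ⟨θ, hθ, fun μ hμ => ⟨?_, ?_⟩, fun rate hr => ?_⟩
  · rintro ⟨p, hp, hpμ⟩
    have := hp.isMarkovKernel
    refine PartitionAtMost.eq_of_marginal_vecMul_eq (PartitionAtMost.transitionMatrix ν) hk
      (PartitionAtMost.chainKernel ν) (PartitionAtMost.marginal_chainKernel ν)
      (fun n => PartitionAtMost.transitionProb_oneBlock_pos hk ν) (fun n => ?_) fun n => ?_
    -- Any chain kernel `p` has the same finite transition matrices, so its invariant laws satisfy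
    -- the same vector equations; `p` need not be identified with `chainKernel ν`.
    · rw [← PartitionAtMost.marginal_bind (κ := p) (K := PartitionAtMost.transitionMatrix ν n)
        fun A => funext (hp.restrict_eq n A), hpμ.def]
    · rw [← PartitionAtMost.marginal_bind (PartitionAtMost.marginal_chainKernel ν n), hinv.def]
  · rintro rfl
    exact ⟨_, PartitionAtMost.isChainKernel_chainKernel ν, hinv⟩
  have hT := PartitionAtMost.isRhoMarkovSemigroup_semigroup hr.le ν
  have := hT.isMarkovKernel
  have hTinv (t : ℝ≥0) : (PartitionAtMost.semigroup rate ν t).Invariant θ :=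
    hinv.poissonIterate (by positivity)
  have hθT (t : ℝ≥0) (n : ℕ) :
      Matrix.vecMul (PartitionAtMost.marginal θ n)
        (NormedSpace.exp ((t : ℝ) • rateMatrix rate ν n)) = PartitionAtMost.marginal θ n := by
    rw [← PartitionAtMost.marginal_bind (κ := PartitionAtMost.semigroup rate ν t)
      fun A => funext (hT.restrict_eq t n A), (hTinv t).def]
  -- Invariance at the single time `1` already forces `θ`; any positive time would do.
  have huniq {μ : Measure (PartitionAtMost ℕ k)} [IsProbabilityMeasure μ]
      (h : ∀ n, Matrix.vecMul (PartitionAtMost.marginal μ n)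
        (NormedSpace.exp (((1 : ℝ≥0) : ℝ) • rateMatrix rate ν n)) =
          PartitionAtMost.marginal μ n) : μ = θ :=
    PartitionAtMost.eq_of_marginal_vecMul_eq _ hk (PartitionAtMost.semigroup rate ν 1)
      (fun n A => funext (hT.restrict_eq 1 n A))
      (fun n B => PartitionAtMost.exp_rateMatrix_oneBlock_pos hk hr (by simp) ν n B) h (hθT 1)
  refine ⟨fun μ hμ => ⟨?_, ?_⟩, fun P _ B hB => ⟨fun h => ?_, fun h t => ?_⟩⟩
  · rintro ⟨T, hT', hTμ⟩
    have := hT'.isMarkovKernel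
    refine huniq fun n => ?_
    rw [← PartitionAtMost.marginal_bind (κ := T 1) fun A => funext (hT'.restrict_eq 1 n A),
      (hTμ 1).def]
  · rintro rfl
    exact ⟨_, hT, hTinv⟩
  · have := Measure.isProbabilityMeasure_map (μ := P) (hB.measurable 0).aemeasurable
    refine huniq fun n => ?_
    rw [← PartitionAtMost.marginal_map_process hB, h 1]
  · have := Measure.isProbabilityMeasure_map (μ := P) (hB.measurable t).aemeasurable
    rw [h]
    refine PartitionAtMost.marginal_ext fun n => ?_
    rw [PartitionAtMost.marginal_map_process hB, h, hθT]
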